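/- Let $d\in\mathbb N$ and let $p,q\in(1,\infty)$ satisfy $1/p+1/q=1$. Let $L^p(\mathbb R^d)$ be the space of real- or complex-valued $p$-integrable functions with respect to Lebesgue measure, with scalar field $\mathbb K=\mathbb R$ or $\mathbb C$ accordingly. For a Banach space $X$ over $\mathbb K$, a real number $1<r<\infty$ and a sequence $(f_n)_{n=1}^\infty$ in $X$ we use the following terms. - $(f_n)$ is an *unconditional basis* of $X$ if for every $x\in X$ there is a unique sequence of scalars $(a_n)$ such that $x=\sum_n a_nf_n$ with unconditional convergence; it is *seminormalized* if $0<\inf_n\|f_n\|\le\sup_n\|f_n\|<\infty$. - $(f_n)$ is an *$r$-Bessel sequence* if there is a constant $B>0$ such that $\sum_n|\langle h,f_n\rangle|^r\le B\|h\|^r$ for all $h\in X^*$; a *Bessel sequence* is a $2$-Bessel sequence. - $(f_n)$ is a *$(C_r)$-system* in $X$ if there is a constant $C>0$ such that for every $x\in X$ and every $\varepsilon>0$ there is a finite linear combination $g=\sum_n a_nf_n$ with $\|x-g\|<\varepsilon$ and $\big(\sum_n|a_n|^r\big)^{1/r}\le C\|x\|$. Then: (i) If $1<p\le 2$, then every seminormalized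 unconditional basis of $L^p(\mathbb R^d)$ is both a $q$-Bessel sequence and a $(C_2)$-system in $L^p(\mathbb R^d)$. (ii) If $2\le p<\infty$, then every seminormalized unconditional basis of $L^p(\mathbb R^d)$ is both a Bessel sequence and a $(C_p)$-system in $L^p(\mathbb R^d)$. -/

import Mathlib

open MeasureTheory

namespace BanachSequence

variable (𝕜 : Type*) [RCLike 𝕜] {X : Type*} [NormedAddCommGroup X] [NormedSpace 𝕜 X]

/-- `(f n)` is an unconditional basis of `X`: every `x` has a unique expansion
`x = ∑ a n • f n` that converges unconditionally (`HasSum`: the net of all finite partial sums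
converges, which is convergence to `x` under every reordering of the terms). The coordinate
functionals are not part of the definition, and their continuity is not assumed. -/
def IsUnconditionalBasis (f : ℕ → X) : Prop :=
  ∀ x : X, ∃! a : ℕ → 𝕜, HasSum (fun n => a n • f n) x

/-- `(f n)` is seminormalized: `0 < inf ‖f n‖ ≤ sup ‖f n‖ < ∞`. -/
def IsSeminormalized {X : Type*} [NormedAddCommGroup X] (f : ℕ → X) : Prop :=
  ∃ c C : ℝ, 0 < c ∧ ∀ n, c ≤ ‖f n‖ ∧ ‖f n‖ ≤ C

/-- `(f n)` is an `r`-Bessel sequence: for some `B > 0`, every functional `h` in the dual of `X`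
satisfies `∑ |⟨h, f n⟩| ^ r ≤ B * ‖h‖ ^ r`, the series being convergent. -/
def IsBesselSequence (r : ℝ) (f : ℕ → X) : Prop :=
  ∃ B : ℝ, 0 < B ∧ ∀ h : StrongDual 𝕜 X,
    Summable (fun n => ‖h (f n)‖ ^ r) ∧ ∑' n, ‖h (f n)‖ ^ r ≤ B * ‖h‖ ^ r

/-- `(f n)` is a `(C_r)`-system (complete with `ℓ_r` control over the coefficients): for some
`C > 0`, every `x` can be approximated arbitrarily well by finite linear combinations of the
`f n` whose coefficients have `ℓ_r`-norm at most `C * ‖x‖`. -/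
def IsCSystem (r : ℝ) (f : ℕ → X) : Prop :=
  ∃ C : ℝ, 0 < C ∧ ∀ x : X, ∀ ε : ℝ, 0 < ε →
    ∃ a : ℕ →₀ 𝕜, ‖x - ∑ n ∈ a.support, a n • f n‖ < ε ∧
      (∑ n ∈ a.support, ‖a n‖ ^ r) ^ (1 / r) ≤ C * ‖x‖

end BanachSequence

/-! The geometry of `L^p` enters only through estimates for the pair `u + v`, `u - v`: the average
of the two `p`-th powers is at most `‖u‖^p + ‖v‖^p` for `p ≤ 2` and at least that for `p ≥ 2`, with
constant-weighted quadratic counterparts `(‖u‖² + C‖v‖²)^(p/2)` in the opposite directions. Hence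
one of the two signs is always good, and adding vectors one at a time yields some choice of signs
with an upper or lower `r`-estimate.

For an unconditional basis all sign choices have comparable norms
(`IsUnconditionalBasis.exists_norm_sum_signs_le`), so one good choice suffices. A lower `r`-estimate
bounds the coefficients of every expansion in `ℓ_r` (`isCSystem`); an upper `s`-estimate gives by
duality the Bessel property for the conjugate exponent (`isBesselSequence`). -/

section TwoPoint

/-! ### Two-point inequalities in an inner product space. -/

theorem norm_rpow_eq_sq_rpow_half {E : Type*} [NormedAddCommGroup E] (a : E) (p : ℝ) : ‖a‖ ^ p = (‖a‖ ^ 2) ^ (p / 2) := by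
  rw [← Real.rpow_natCast_mul (norm_nonneg a)]
  congr 1
  push_cast
  ring

variable {E : Type*} [NormedAddCommGroup E] [InnerProductSpace ℝ E]

theorem half_sq_norm_add_sub (a b : E) :
    (1 / 2 : ℝ) * ‖a + b‖ ^ 2 + (1 / 2) * ‖a - b‖ ^ 2 = ‖a‖ ^ 2 + ‖b‖ ^ 2 := by
  rw [norm_add_sq_real, norm_sub_sq_real]
  ring

/-- The parallelogram law, concavity of `t ^ (p / 2)` and then its subadditivity. For `p ≥ 2`
convexity and superadditivity reverse both steps. -/
theorem norm_add_sub_rpow_le {p : ℝ} (hp : 0 < p) (hp2 : p ≤ 2) (a b : E) :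
    (‖a + b‖ ^ p + ‖a - b‖ ^ p) / 2 ≤ ‖a‖ ^ p + ‖b‖ ^ p := by
  have h := (Real.concaveOn_rpow (p := p / 2) (by linarith) (by linarith)).2
    (Set.mem_Ici.2 (sq_nonneg ‖a + b‖))
    (Set.mem_Ici.2 (sq_nonneg ‖a - b‖))
    (show (0 : ℝ) ≤ 1 / 2 by norm_num) (show (0 : ℝ) ≤ 1 / 2 by norm_num) (by norm_num)
  simp only [smul_eq_mul, half_sq_norm_add_sub] at h
  have h2 := Real.rpow_add_le_add_rpow (sq_nonneg ‖a‖) (sq_nonneg ‖b‖)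
    (show 0 ≤ p / 2 by linarith) (by linarith)
  simp only [norm_rpow_eq_sq_rpow_half _ p]
  linarith

theorem le_norm_add_sub_rpow {p : ℝ} (hp : 2 ≤ p) (a b : E) :
    ‖a‖ ^ p + ‖b‖ ^ p ≤ (‖a + b‖ ^ p + ‖a - b‖ ^ p) / 2 := by
  have h := (convexOn_rpow (p := p / 2) (by linarith)).2
    (Set.mem_Ici.2 (sq_nonneg ‖a + b‖))
    (Set.mem_Ici.2 (sq_nonneg ‖a - b‖))
    (show (0 : ℝ) ≤ 1 / 2 by norm_num) (show (0 : ℝ) ≤ 1 / 2 by norm_num) (by norm_num)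
  simp only [smul_eq_mul, half_sq_norm_add_sub] at h
  have h2 := Real.add_rpow_le_rpow_add (sq_nonneg ‖a‖) (sq_nonneg ‖b‖)
    (show 1 ≤ p / 2 by linarith)
  simp only [norm_rpow_eq_sq_rpow_half _ p]
  linarith

theorem exp_le_one_add_mul {x k : ℝ} (hx : 0 ≤ x) (hxk : x ≤ k) :
    Real.exp x ≤ 1 + Real.exp k * x := by
  have h1 := Real.add_one_le_exp (-x)
  have h2 : Real.exp x * Real.exp (-x) = 1 := by rw [← Real.exp_add]; simp
  have h3 := mul_le_mul_of_nonneg_left h1 (Real.exp_pos x).le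
  have h4 := mul_le_mul_of_nonneg_right (Real.exp_le_exp.2 hxk) hx
  nlinarith

/-- The scalar two-point inequality behind the 2-smoothness of `L^p`, `p ≥ 2`. -/
theorem exists_norm_add_sub_rpow_le_sq {p : ℝ} (hp : 2 ≤ p) :
    ∃ C : ℝ, 1 ≤ C ∧ ∀ (F : Type*) [NormedAddCommGroup F] [InnerProductSpace ℝ F] (a b : F),
      (‖a + b‖ ^ p + ‖a - b‖ ^ p) / 2 ≤ (‖a‖ ^ 2 + C * ‖b‖ ^ 2) ^ (p / 2) := by
  set k := 1 + p with hk
  have hek : 1 ≤ Real.exp k := Real.one_le_exp (by linarith)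
  have hC : 4 ≤ Real.exp k * k + 1 := by nlinarith
  refine ⟨Real.exp k * k + 1, by linarith, fun F _ _ a b => ?_⟩
  set C := Real.exp k * k + 1 with hCdef
  set s := p / 2 with hs
  have hs0 : 0 < s := by linarith
  have hsq : ∀ x : F, ‖x‖ ^ p = (‖x‖ ^ 2) ^ s := fun x => norm_rpow_eq_sq_rpow_half x p
  simp only [hsq]
  -- If `‖a‖ ≤ ‖b‖`, then `C ≥ 4` suffices. Otherwise `‖a ± b‖² = ‖a‖² (1 + y² ± τ)` with `|τ| ≤
  -- 2y`; bounding `1 + t` by `exp t`, the average over signs becomes `cosh (s τ) ≤ exp (s² τ² /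
  -- 2)`, which is quadratic in `y`.
  rcases le_or_gt ‖a‖ ‖b‖ with hab | hab
  · have key : ∀ x : F, ‖x‖ ≤ ‖a‖ + ‖b‖ → (‖x‖ ^ 2) ^ s ≤ (‖a‖ ^ 2 + C * ‖b‖ ^ 2) ^ s := by
      intro x hx
      refine Real.rpow_le_rpow (sq_nonneg _) ?_ hs0.le
      have : ‖x‖ ≤ 2 * ‖b‖ := by linarith
      nlinarith [norm_nonneg x, sq_nonneg ‖a‖, sq_nonneg ‖b‖, norm_nonneg b]
    linarith [key _ (norm_add_le a b), key _ (norm_sub_le a b)]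
  · have ha : 0 < ‖a‖ := (norm_nonneg b).trans_lt hab
    set y := ‖b‖ / ‖a‖ with hy
    have hy0 : 0 ≤ y := by positivity
    have hy1 : y ≤ 1 := (div_le_one ha).2 hab.le
    have hb : ‖b‖ = ‖a‖ * y := by rw [hy]; field_simp
    set τ := 2 * inner ℝ a b / ‖a‖ ^ 2 with hτ
    have hin : 2 * inner ℝ a b = ‖a‖ ^ 2 * τ := by rw [hτ]; field_simp
    have hτy : τ ^ 2 ≤ 4 * y ^ 2 := by
      have h1 : |τ| ≤ 2 * y := by
        rw [hτ, abs_div, abs_mul, abs_of_pos (show (0 : ℝ) < 2 by norm_num),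
          abs_of_pos (show 0 < ‖a‖ ^ 2 by positivity), div_le_iff₀ (by positivity)]
        have := abs_real_inner_le_norm a b
        rw [hb] at this
        nlinarith
      have := sq_le_sq' (by linarith [abs_nonneg τ]) h1
      rw [sq_abs] at this
      nlinarith
    have hpos : ∀ x : F, ∀ σ : ℝ, ‖x‖ ^ 2 = ‖a‖ ^ 2 * (1 + (y ^ 2 + σ)) →
        (‖x‖ ^ 2) ^ s ≤ (‖a‖ ^ 2) ^ s * (Real.exp (s * y ^ 2) * Real.exp (s * σ)) := by
      intro x σ hx
      have h0 : 0 ≤ 1 + (y ^ 2 + σ) := by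
        by_contra hcon
        have h1 : 0 < ‖a‖ ^ 2 := by positivity
        nlinarith [sq_nonneg ‖x‖]
      rw [hx, Real.mul_rpow (sq_nonneg _) h0]
      refine mul_le_mul_of_nonneg_left ?_ (by positivity)
      calc (1 + (y ^ 2 + σ)) ^ s ≤ (Real.exp (y ^ 2 + σ)) ^ s :=
            Real.rpow_le_rpow h0 (by linarith [Real.add_one_le_exp (y ^ 2 + σ)]) hs0.le
        _ = _ := by rw [← Real.exp_mul, ← Real.exp_add]; ring_nf
    have h1 := hpos (a + b) τ (by rw [norm_add_sq_real, hin, hb]; ring)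
    have h2 := hpos (a - b) (-τ) (by rw [norm_sub_sq_real, hin, hb]; ring)
    have hcosh : (Real.exp (s * τ) + Real.exp (s * (-τ))) / 2 ≤ Real.exp (s * (p * y ^ 2)) := by
      have h3 := Real.cosh_le_exp_half_sq (s * τ)
      rw [Real.cosh_eq] at h3
      rw [mul_neg]
      refine h3.trans (Real.exp_le_exp.2 ?_)
      have : p = 2 * s := by rw [hs]; ring
      rw [this]
      nlinarith [mul_le_mul_of_nonneg_left hτy (sq_nonneg s)]
    calc ((‖a + b‖ ^ 2) ^ s + (‖a - b‖ ^ 2) ^ s) / 2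
        ≤ (‖a‖ ^ 2) ^ s * (Real.exp (s * y ^ 2) *
            ((Real.exp (s * τ) + Real.exp (s * (-τ))) / 2)) := by linarith
      _ ≤ (‖a‖ ^ 2) ^ s * (Real.exp (s * y ^ 2) * Real.exp (s * (p * y ^ 2))) := by gcongr
      _ = (‖a‖ ^ 2) ^ s * (Real.exp (k * y ^ 2)) ^ s := by
          rw [← Real.exp_mul, ← Real.exp_add, hk]; ring_nf
      _ ≤ (‖a‖ ^ 2) ^ s * (1 + C * y ^ 2) ^ s := by
          gcongr
          have := exp_le_one_add_mul (x := k * y ^ 2) (k := k) (by positivity)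
            (mul_le_of_le_one_right (by linarith) (pow_le_one₀ hy0 hy1))
          rw [hCdef]
          nlinarith [sq_nonneg y]
      _ = (‖a‖ ^ 2 + C * ‖b‖ ^ 2) ^ s := by
          rw [← Real.mul_rpow (sq_nonneg _) (by positivity), hb]; ring_nf

/-- The scalar two-point inequality behind the 2-uniform convexity of `L^p`, `1 < p ≤ 2`; it is
dual to `exists_norm_add_sub_rpow_le_sq`. -/
theorem exists_sq_le_norm_add_sub_rpow {p : ℝ} (hp : 1 < p) (hp2 : p ≤ 2) :
    ∃ c : ℝ, 0 < c ∧ c ≤ 1 ∧ ∀ (F : Type*) [NormedAddCommGroup F] [InnerProductSpace ℝ F]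
      (a b : F), (‖a‖ ^ 2 + c * ‖b‖ ^ 2) ^ (p / 2) ≤ (‖a + b‖ ^ p + ‖a - b‖ ^ p) / 2 := by
  have hpq : p.HolderConjugate (Real.conjExponent p) := Real.HolderConjugate.conjExponent hp
  set q := Real.conjExponent p
  have hq : 2 ≤ q := by
    have := hpq.sub_one_mul_conj
    nlinarith
  obtain ⟨C, hC, h⟩ := exists_norm_add_sub_rpow_le_sq hq
  have hC0 : 0 < C := by linarith
  refine ⟨1 / C, by positivity, (div_le_one hC0).2 hC, fun F _ _ a b => ?_⟩
  set D := ‖a‖ ^ 2 + 1 / C * ‖b‖ ^ 2 with hD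
  have hD0 : 0 ≤ D := by positivity
  rcases hD0.eq_or_lt with hD0 | hD0
  · rw [← hD0, Real.zero_rpow (by linarith)]; positivity
  -- This scaling gives `‖a‖² + C‖b'‖² = ‖a‖² + ⟪b, b'⟫ = D`, so the pairing of `(a + b, a - b)`
  -- with `(a + b', a - b')` is exactly `2 * D` and Hölder on two points can be inverted.
  set b' := (1 / C) • b with hb'
  have hnb' : C * ‖b'‖ ^ 2 = 1 / C * ‖b‖ ^ 2 := by
    rw [hb', norm_smul, Real.norm_of_nonneg (by positivity)]; field_simp
  have hdual := h F a b'
  rw [hnb', ← hD] at hdual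
  set P := (‖a + b‖ ^ p + ‖a - b‖ ^ p) / 2 with hP
  set Q := (‖a + b'‖ ^ q + ‖a - b'‖ ^ q) / 2 with hQ
  have hP0 : 0 ≤ P := by positivity
  have hQ0 : 0 ≤ Q := by positivity
  have hinner : 2 * D = inner ℝ (a + b) (a + b') + inner ℝ (a - b) (a - b') := by
    have e1 : inner ℝ b b' = 1 / C * ‖b‖ ^ 2 := by
      rw [hb', real_inner_smul_right, real_inner_self_eq_norm_sq]
    simp only [inner_add_left, inner_add_right, inner_sub_left, inner_sub_right,
      real_inner_self_eq_norm_sq, e1]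
    rw [hD]; ring
  have hH := Real.inner_le_Lp_mul_Lq_of_nonneg (s := Finset.univ)
    (f := ![‖a + b‖, ‖a - b‖]) (g := ![‖a + b'‖, ‖a - b'‖]) hpq
    (by intro i _; fin_cases i <;> simp) (by intro i _; fin_cases i <;> simp)
  simp only [Fin.sum_univ_two, Matrix.cons_val_zero, Matrix.cons_val_one] at hH
  rw [show ‖a + b‖ ^ p + ‖a - b‖ ^ p = 2 * P by rw [hP]; ring,
    show ‖a + b'‖ ^ q + ‖a - b'‖ ^ q = 2 * Q by rw [hQ]; ring,
    Real.mul_rpow (by norm_num) hP0, Real.mul_rpow (by norm_num) hQ0] at hH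
  have h2 : (2 : ℝ) ^ (1 / p) * 2 ^ (1 / q) = 2 := by
    rw [← Real.rpow_add (by norm_num), one_div, one_div, hpq.inv_add_inv_eq_one, Real.rpow_one]
  have hQD : Q ^ (1 / q) ≤ D ^ (1 / 2 : ℝ) := by
    calc Q ^ (1 / q) ≤ (D ^ (q / 2)) ^ (1 / q) :=
          Real.rpow_le_rpow hQ0 hdual (by positivity)
      _ = D ^ (1 / 2 : ℝ) := by
          rw [← Real.rpow_mul hD0.le]; congr 1; field_simp
  have hDle : D ≤ P ^ (1 / p) * D ^ (1 / 2 : ℝ) := by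
    have h3 := real_inner_le_norm (a + b) (a + b')
    have h4 := real_inner_le_norm (a - b) (a - b')
    have h5 : 2 * D ≤ 2 * (P ^ (1 / p) * Q ^ (1 / q)) := by
      calc 2 * D ≤ (2 : ℝ) ^ (1 / p) * P ^ (1 / p) * (2 ^ (1 / q) * Q ^ (1 / q)) := by linarith
        _ = ((2 : ℝ) ^ (1 / p) * 2 ^ (1 / q)) * (P ^ (1 / p) * Q ^ (1 / q)) := by ring
        _ = _ := by rw [h2]
    have h6 : P ^ (1 / p) * Q ^ (1 / q) ≤ P ^ (1 / p) * D ^ (1 / 2 : ℝ) := by gcongr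
    linarith
  have hhalf : D ^ (1 / 2 : ℝ) ≤ P ^ (1 / p) := by
    have h7 : D = D ^ (1 / 2 : ℝ) * D ^ (1 / 2 : ℝ) := by
      rw [← Real.rpow_add hD0]; norm_num
    have h8 : 0 < D ^ (1 / 2 : ℝ) := by positivity
    nlinarith
  calc D ^ (p / 2) = (D ^ (1 / 2 : ℝ)) ^ p := by
        rw [← Real.rpow_mul hD0.le]; congr 1; ring
    _ ≤ (P ^ (1 / p)) ^ p := by gcongr
    _ = P := by
        rw [← Real.rpow_mul hP0, one_div_mul_cancel (by linarith), Real.rpow_one]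

theorem mul_div_rpow_eq {X l m s : ℝ} (hX : 0 ≤ X) (hl : 0 < l) (hm : 0 < m) :
    l / (l + m) * (X / (l / (l + m))) ^ s = (l + m) ^ (s - 1) * (l ^ (1 - s) * X ^ s) := by
  rw [Real.div_rpow hX (by positivity), Real.div_rpow hl.le (by positivity),
    Real.rpow_sub_one (by positivity), Real.rpow_sub hl, Real.rpow_one]
  field_simp

/-- Jensen with weights `l / (l + m)` and `m / (l + m)`. The right side is linear in `X ^ s` and `Y
^ s`, hence can be integrated; no loss occurs when `X / l = Y / m`. -/
theorem add_rpow_le_weighted {X Y l m s : ℝ} (hs : 1 ≤ s) (hX : 0 ≤ X) (hY : 0 ≤ Y)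
    (hl : 0 < l) (hm : 0 < m) :
    (X + Y) ^ s ≤ (l + m) ^ (s - 1) * (l ^ (1 - s) * X ^ s + m ^ (1 - s) * Y ^ s) := by
  have h := (convexOn_rpow hs).2
    (show X / (l / (l + m)) ∈ Set.Ici (0 : ℝ) from by simp only [Set.mem_Ici]; positivity)
    (show Y / (m / (m + l)) ∈ Set.Ici (0 : ℝ) from by simp only [Set.mem_Ici]; positivity)
    (show 0 ≤ l / (l + m) by positivity) (show 0 ≤ m / (m + l) by positivity)
    (by rw [add_comm m l]; field_simp)
  simp only [smul_eq_mul] at h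
  rw [mul_div_rpow_eq hX hl hm, mul_div_rpow_eq hY hm hl, mul_div_cancel₀ _ (by positivity),
    mul_div_cancel₀ _ (by positivity), add_comm m l, ← mul_add] at h
  exact h

theorem weighted_le_add_rpow {X Y l m s : ℝ} (hs0 : 0 ≤ s) (hs : s ≤ 1) (hX : 0 ≤ X)
    (hY : 0 ≤ Y) (hl : 0 < l) (hm : 0 < m) :
    (l + m) ^ (s - 1) * (l ^ (1 - s) * X ^ s + m ^ (1 - s) * Y ^ s) ≤ (X + Y) ^ s := by
  have h := (Real.concaveOn_rpow hs0 hs).2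
    (show X / (l / (l + m)) ∈ Set.Ici (0 : ℝ) from by simp only [Set.mem_Ici]; positivity)
    (show Y / (m / (m + l)) ∈ Set.Ici (0 : ℝ) from by simp only [Set.mem_Ici]; positivity)
    (show 0 ≤ l / (l + m) by positivity) (show 0 ≤ m / (m + l) by positivity)
    (by rw [add_comm m l]; field_simp)
  simp only [smul_eq_mul] at h
  rw [mul_div_rpow_eq hX hl hm, mul_div_rpow_eq hY hm hl, mul_div_cancel₀ _ (by positivity),
    mul_div_cancel₀ _ (by positivity), add_comm m l, ← mul_add] at h
  exact h

end TwoPoint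

/-! ### Integration of the two-point inequalities to `L^p`. -/

section LpTwoPoint

variable {Ω : Type*} [MeasurableSpace Ω] {μ : Measure Ω} {E : Type*} [NormedAddCommGroup E]
  {p : ℝ}

theorem Lp_norm_rpow_eq_integral (hp : 0 < p) (u : Lp E (ENNReal.ofReal p) μ) :
    ‖u‖ ^ p = ∫ x, ‖u x‖ ^ p ∂μ := by
  rw [Lp.norm_def, MemLp.eLpNorm_eq_integral_rpow_norm (by simpa using hp) ENNReal.ofReal_ne_top
    (Lp.memLp u), ENNReal.toReal_ofReal hp.le,
    ENNReal.toReal_ofReal (by positivity), ← Real.rpow_mul (by positivity),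
    inv_mul_cancel₀ hp.ne', Real.rpow_one]

theorem Lp_integrable_norm_rpow (hp : 0 < p) (u : Lp E (ENNReal.ofReal p) μ) :
    Integrable (fun x => ‖u x‖ ^ p) μ := by
  have := (Lp.memLp u).integrable_norm_rpow (by simpa using hp) ENNReal.ofReal_ne_top
  rwa [ENNReal.toReal_ofReal hp.le] at this

theorem Lp_half_norm_add_sub_rpow (hp : 0 < p) (u v : Lp E (ENNReal.ofReal p) μ) :
    Integrable (fun x => (‖u x + v x‖ ^ p + ‖u x - v x‖ ^ p) / 2) μ ∧
      (‖u + v‖ ^ p + ‖u - v‖ ^ p) / 2 = ∫ x, (‖u x + v x‖ ^ p + ‖u x - v x‖ ^ p) / 2 ∂μ := by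
  have e : (fun x => (‖(u + v) x‖ ^ p + ‖(u - v) x‖ ^ p) / 2) =ᵐ[μ]
      fun x => (‖u x + v x‖ ^ p + ‖u x - v x‖ ^ p) / 2 := by
    filter_upwards [Lp.coeFn_add u v, Lp.coeFn_sub u v] with x h1 h2
    simp only [h1, h2, Pi.add_apply, Pi.sub_apply]
  have i1 := Lp_integrable_norm_rpow hp (u + v)
  have i2 := Lp_integrable_norm_rpow hp (u - v)
  refine ⟨((i1.add i2).div_const 2).congr e, ?_⟩
  rw [← integral_congr_ae e, integral_div, integral_add i1 i2, Lp_norm_rpow_eq_integral hp,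
    Lp_norm_rpow_eq_integral hp]

/-- The weights `l = ‖u‖²`, `m = C‖v‖²` make the two terms integrate to `l` and `m`, so the Jensen
bound collapses to `(l + m) ^ (p / 2)`. This plays the role of Minkowski's inequality in `L^(p/2)`.
-/
theorem Lp_integral_weighted [Fact (1 ≤ ENNReal.ofReal p)] {C : ℝ} (hC : 0 < C) (hp : 0 < p)
    (u v : Lp E (ENNReal.ofReal p) μ) (hu : 0 < ‖u‖) (hv : 0 < ‖v‖) :
    Integrable (fun x => (‖u‖ ^ 2 + C * ‖v‖ ^ 2) ^ (p / 2 - 1) *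
      ((‖u‖ ^ 2) ^ (1 - p / 2) * (‖u x‖ ^ 2) ^ (p / 2) +
        (C * ‖v‖ ^ 2) ^ (1 - p / 2) * (C * ‖v x‖ ^ 2) ^ (p / 2))) μ ∧
    ∫ x, (‖u‖ ^ 2 + C * ‖v‖ ^ 2) ^ (p / 2 - 1) *
      ((‖u‖ ^ 2) ^ (1 - p / 2) * (‖u x‖ ^ 2) ^ (p / 2) +
        (C * ‖v‖ ^ 2) ^ (1 - p / 2) * (C * ‖v x‖ ^ 2) ^ (p / 2)) ∂μ =
      (‖u‖ ^ 2 + C * ‖v‖ ^ 2) ^ (p / 2) := by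
  have iu := (Lp_integrable_norm_rpow hp u).const_mul ((‖u‖ ^ 2) ^ (1 - p / 2))
  have iv := ((Lp_integrable_norm_rpow hp v).const_mul (C ^ (p / 2))).const_mul
    ((C * ‖v‖ ^ 2) ^ (1 - p / 2))
  have hs : ∀ x : E, (‖x‖ ^ 2) ^ (p / 2) = ‖x‖ ^ p :=
    fun x => (norm_rpow_eq_sq_rpow_half x p).symm
  have key : ∀ {t : ℝ}, 0 < t → t ^ (1 - p / 2) * t ^ (p / 2) = t := fun ht => by
    rw [← Real.rpow_add ht, sub_add_cancel, Real.rpow_one]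
  simp only [Real.mul_rpow hC.le (sq_nonneg (_ : ℝ)), hs] at iv ⊢
  refine ⟨(iu.add iv).const_mul _, ?_⟩
  rw [integral_const_mul, integral_add iu iv, integral_const_mul, integral_const_mul,
    integral_const_mul, ← Lp_norm_rpow_eq_integral hp, ← Lp_norm_rpow_eq_integral hp,
    norm_rpow_eq_sq_rpow_half u, norm_rpow_eq_sq_rpow_half v, key (by positivity)]
  have h2 := key (show 0 < C * ‖v‖ ^ 2 by positivity)
  rw [Real.mul_rpow hC.le (sq_nonneg _), Real.mul_rpow hC.le (sq_nonneg _)] at h2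
  rw [h2, ← Real.rpow_add_one (by positivity), sub_add_cancel]

variable [InnerProductSpace ℝ E]

theorem Lp_norm_add_sub_rpow_le (hp : 0 < p) (hp2 : p ≤ 2) (u v : Lp E (ENNReal.ofReal p) μ) :
    (‖u + v‖ ^ p + ‖u - v‖ ^ p) / 2 ≤ ‖u‖ ^ p + ‖v‖ ^ p := by
  obtain ⟨hi, he⟩ := Lp_half_norm_add_sub_rpow hp u v
  have iu := Lp_integrable_norm_rpow hp u
  have iv := Lp_integrable_norm_rpow hp v
  rw [he, Lp_norm_rpow_eq_integral hp, Lp_norm_rpow_eq_integral hp, ← integral_add iu iv]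
  exact integral_mono hi (iu.add iv) fun x => norm_add_sub_rpow_le hp hp2 _ _

theorem Lp_le_norm_add_sub_rpow (hp : 2 ≤ p) (u v : Lp E (ENNReal.ofReal p) μ) :
    ‖u‖ ^ p + ‖v‖ ^ p ≤ (‖u + v‖ ^ p + ‖u - v‖ ^ p) / 2 := by
  have hp0 : 0 < p := by linarith
  obtain ⟨hi, he⟩ := Lp_half_norm_add_sub_rpow hp0 u v
  have iu := Lp_integrable_norm_rpow hp0 u
  have iv := Lp_integrable_norm_rpow hp0 v
  rw [he, Lp_norm_rpow_eq_integral hp0, Lp_norm_rpow_eq_integral hp0, ← integral_add iu iv]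
  exact integral_mono (iu.add iv) hi fun x => le_norm_add_sub_rpow hp _ _

/-- `L^p` is 2-smooth for `p ≥ 2`, up to a constant. -/
theorem exists_Lp_norm_add_sub_rpow_le_sq [Fact (1 ≤ ENNReal.ofReal p)]
    (hp : 2 ≤ p) :
    ∃ C : ℝ, 1 ≤ C ∧ ∀ u v : Lp E (ENNReal.ofReal p) μ,
      (‖u + v‖ ^ p + ‖u - v‖ ^ p) / 2 ≤ (‖u‖ ^ 2 + C * ‖v‖ ^ 2) ^ (p / 2) := by
  obtain ⟨C, hC, h⟩ := exists_norm_add_sub_rpow_le_sq hp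
  have hp0 : 0 < p := by linarith
  have hC0 : 0 < C := by linarith
  refine ⟨C, hC, fun u v => ?_⟩
  -- The Jensen weights must be positive, so `u = 0` and `v = 0` are treated apart.
  rcases (norm_nonneg u).eq_or_lt with hu | hu
  · have hu' : u = 0 := norm_eq_zero.1 hu.symm
    subst hu'
    simp only [zero_add, zero_sub, norm_neg, add_self_div_two, norm_zero]
    rw [norm_rpow_eq_sq_rpow_half]
    refine Real.rpow_le_rpow (sq_nonneg _) ?_ (by linarith)
    nlinarith [sq_nonneg ‖v‖]
  rcases (norm_nonneg v).eq_or_lt with hv | hv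
  · have hv' : v = 0 := norm_eq_zero.1 hv.symm
    subst hv'
    simp [norm_rpow_eq_sq_rpow_half]
  obtain ⟨hi, he⟩ := Lp_half_norm_add_sub_rpow hp0 u v
  obtain ⟨wi, we⟩ := Lp_integral_weighted hC0 hp0 u v hu hv
  rw [he, ← we]
  exact integral_mono hi wi fun x => (h E _ _).trans <|
    add_rpow_le_weighted (by linarith) (by positivity) (by positivity) (by positivity)
      (by positivity)

/-- `L^p` is 2-uniformly convex for `1 < p ≤ 2`, up to a constant. -/
theorem exists_Lp_sq_le_norm_add_sub_rpow [Fact (1 ≤ ENNReal.ofReal p)]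
    (hp : 1 < p) (hp2 : p ≤ 2) :
    ∃ c : ℝ, 0 < c ∧ c ≤ 1 ∧ ∀ u v : Lp E (ENNReal.ofReal p) μ,
      (‖u‖ ^ 2 + c * ‖v‖ ^ 2) ^ (p / 2) ≤ (‖u + v‖ ^ p + ‖u - v‖ ^ p) / 2 := by
  obtain ⟨c, hc0, hc, h⟩ := exists_sq_le_norm_add_sub_rpow hp hp2
  have hp0 : 0 < p := by linarith
  refine ⟨c, hc0, hc, fun u v => ?_⟩
  rcases (norm_nonneg u).eq_or_lt with hu | hu
  · have hu' : u = 0 := norm_eq_zero.1 hu.symm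
    subst hu'
    simp only [zero_add, zero_sub, norm_neg, add_self_div_two, norm_zero]
    rw [norm_rpow_eq_sq_rpow_half v]
    refine Real.rpow_le_rpow (by positivity) ?_ (by linarith)
    nlinarith [sq_nonneg ‖v‖]
  rcases (norm_nonneg v).eq_or_lt with hv | hv
  · have hv' : v = 0 := norm_eq_zero.1 hv.symm
    subst hv'
    simp [norm_rpow_eq_sq_rpow_half]
  obtain ⟨hi, he⟩ := Lp_half_norm_add_sub_rpow hp0 u v
  obtain ⟨wi, we⟩ := Lp_integral_weighted hc0 hp0 u v hu hv
  rw [he, ← we]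
  exact integral_mono wi hi fun x => (h E _ _).trans' <|
    weighted_le_add_rpow (by linarith) (by linarith) (by positivity) (by positivity)
      (by positivity) (by positivity)

end LpTwoPoint

open Filter Topology

/-! ### Greedy choice of signs. -/

section Signs

variable {X : Type*} [NormedAddCommGroup X]

/-- A two-point upper estimate lets one choose signs greedily so as to have an upper
`r`-estimate. -/
theorem exists_signs_norm_rpow_le {r C : ℝ} (hr : 0 < r)
    (h : ∀ u v : X, ‖u + v‖ ^ r ≤ ‖u‖ ^ r + C * ‖v‖ ^ r ∨ ‖u - v‖ ^ r ≤ ‖u‖ ^ r + C * ‖v‖ ^ r)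
    (v : ℕ → X) (F : Finset ℕ) :
    ∃ ε : ℕ → ℤˣ, ‖∑ n ∈ F, ε n • v n‖ ^ r ≤ C * ∑ n ∈ F, ‖v n‖ ^ r := by
  induction F using Finset.induction_on with
  | empty => exact ⟨1, by simp [Real.zero_rpow hr.ne']⟩
  | insert m F hm ih =>
    obtain ⟨ε, hε⟩ := ih
    have key : ∀ s : ℤˣ, ∑ n ∈ insert m F, Function.update ε m s n • v n =
        ∑ n ∈ F, ε n • v n + s • v m := fun s => by
      rw [Finset.sum_insert hm, add_comm, Function.update_self]
      congr 1
      refine Finset.sum_congr rfl fun n hn => ?_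
      rw [Function.update_of_ne (ne_of_mem_of_not_mem hn hm)]
    rw [Finset.sum_insert hm]
    rcases h (∑ n ∈ F, ε n • v n) (v m) with h1 | h1
    · exact ⟨Function.update ε m 1, by rw [key, one_smul]; linarith⟩
    · exact ⟨Function.update ε m (-1), by
        rw [key, Units.neg_smul, one_smul, ← sub_eq_add_neg]; linarith⟩

/-- A two-point lower estimate lets one choose signs greedily so as to have a lower
`r`-estimate. -/
theorem exists_signs_le_norm_rpow {r c : ℝ} (hr : 0 < r)
    (h : ∀ u v : X, ‖u‖ ^ r + c * ‖v‖ ^ r ≤ ‖u + v‖ ^ r ∨ ‖u‖ ^ r + c * ‖v‖ ^ r ≤ ‖u - v‖ ^ r)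
    (v : ℕ → X) (F : Finset ℕ) :
    ∃ ε : ℕ → ℤˣ, c * ∑ n ∈ F, ‖v n‖ ^ r ≤ ‖∑ n ∈ F, ε n • v n‖ ^ r := by
  induction F using Finset.induction_on with
  | empty => exact ⟨1, by simp [Real.zero_rpow hr.ne']⟩
  | insert m F hm ih =>
    obtain ⟨ε, hε⟩ := ih
    have key : ∀ s : ℤˣ, ∑ n ∈ insert m F, Function.update ε m s n • v n =
        ∑ n ∈ F, ε n • v n + s • v m := fun s => by
      rw [Finset.sum_insert hm, add_comm, Function.update_self]
      congr 1
      refine Finset.sum_congr rfl fun n hn => ?_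
      rw [Function.update_of_ne (ne_of_mem_of_not_mem hn hm)]
    rw [Finset.sum_insert hm]
    rcases h (∑ n ∈ F, ε n • v n) (v m) with h1 | h1
    · exact ⟨Function.update ε m 1, by rw [key, one_smul]; linarith⟩
    · exact ⟨Function.update ε m (-1), by
        rw [key, Units.neg_smul, one_smul, ← sub_eq_add_neg]; linarith⟩

end Signs

/-! ### Unconditional bases: uniform bounds, coefficient control and duality. -/

namespace BanachSequence

variable {𝕜 : Type*} [RCLike 𝕜] {X : Type*} [NormedAddCommGroup X] [NormedSpace 𝕜 X]

theorem exists_norm_sum_le_of_summable {v : ℕ → X} (hv : Summable v) :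
    ∃ M : ℝ, ∀ F : Finset ℕ, ‖∑ n ∈ F, v n‖ ≤ M := by
  have hc := hv.hasSum.cauchySeq
  rw [cauchySeq_finset_iff_vanishing_norm] at hc
  obtain ⟨s, hs⟩ := hc 1 one_pos
  refine ⟨∑ n ∈ s, ‖v n‖ + 1, fun F => ?_⟩
  rw [← Finset.sum_inter_add_sum_sdiff F s]
  refine (norm_add_le _ _).trans (add_le_add ?_ (hs _ Finset.sdiff_disjoint).le)
  exact (norm_sum_le _ _).trans
    (Finset.sum_le_sum_of_subset_of_nonneg Finset.inter_subset_right fun _ _ _ => norm_nonneg _)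

/-- The partial sum operators of an unconditional basis are uniformly bounded. -/
theorem IsUnconditionalBasis.exists_norm_sum_le [CompleteSpace X] {f : ℕ → X}
    (hf : IsUnconditionalBasis 𝕜 f) :
    ∃ K : ℝ, 0 < K ∧ ∀ (x : X) (a : ℕ → 𝕜), HasSum (fun n => a n • f n) x →
      ∀ F : Finset ℕ, ‖∑ n ∈ F, a n • f n‖ ≤ K * ‖x‖ := by
  choose c hc hcu using hf
  have hadd : ∀ x y, c (x + y) = c x + c y := fun x y =>
    (hcu (x + y) (c x + c y) (by simpa [add_smul] using (hc x).add (hc y))).symm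
  have hsmul : ∀ (t : 𝕜) x, c (t • x) = t • c x := fun t x =>
    (hcu (t • x) (t • c x) (by simpa [mul_smul] using (hc x).const_smul t)).symm
  let _ : TopologicalSpace (Finset ℕ) := ⊥
  have : DiscreteTopology (Finset ℕ) := ⟨rfl⟩
  choose M hM using fun x => exists_norm_sum_le_of_summable (hc x).summable
  -- `T x` records all finite partial sums of `x` at once, in the sup norm; a bound for `T` is the
  -- uniform bound sought.
  let T : X →ₗ[𝕜] BoundedContinuousFunction (Finset ℕ) X :=
    { toFun := fun x => BoundedContinuousFunction.ofNormedAddCommGroupDiscrete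
        (fun F => ∑ n ∈ F, c x n • f n) (M x) (hM x)
      map_add' := fun x y => by
        ext F
        simp [hadd, add_smul, Finset.sum_add_distrib]
      map_smul' := fun t x => by
        ext F
        simp [hsmul, mul_smul, Finset.smul_sum] }
  have hT : ∀ x F, T x F = ∑ n ∈ F, c x n • f n := fun _ _ => rfl
  have hcont : Continuous T := by
    -- Continuity of the coordinates is not available. Instead, the limit at `{n}` stays in the
    -- closed line spanned by `f n`, which provides coefficients `b n`; uniform convergence allows
    -- exchanging limits, so they expand `x`, and uniqueness identifies them.
    refine T.continuous_of_seq_closed_graph fun u x φ hu hφ => ?_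
    have hunif := BoundedContinuousFunction.tendsto_iff_tendstoUniformly.1 hφ
    have hpt : ∀ F, Tendsto (fun k => ∑ n ∈ F, c (u k) n • f n) atTop (𝓝 (φ F)) :=
      fun F => hunif.tendsto_at F
    have hspan : ∀ n, φ {n} ∈ Submodule.span 𝕜 {f n} := fun n =>
      (Submodule.closed_of_finiteDimensional (Submodule.span 𝕜 {f n})).mem_of_tendsto (hpt {n})
        (Eventually.of_forall fun k => by
          rw [Finset.sum_singleton]
          exact Submodule.smul_mem _ _ (Submodule.mem_span_singleton_self _))
    choose b hb using fun n => Submodule.mem_span_singleton.1 (hspan n)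
    have hφF : ∀ F, φ F = ∑ n ∈ F, b n • f n := fun F => by
      refine tendsto_nhds_unique (hpt F) (tendsto_finsetSum _ fun n _ => ?_)
      simpa [hb] using hpt {n}
    have hbx : HasSum (fun n => b n • f n) x := by
      have := hunif.tendsto_of_eventually_tendsto (p' := atTop) (L := u) (ℓ := x)
        (Eventually.of_forall fun k => hc (u k)) hu
      exact this.congr hφF
    ext F
    rw [hφF, hT, hcu x b hbx]
  obtain ⟨K, hK, hKb⟩ := (⟨T, hcont⟩ : X →L[𝕜] _).bound
  refine ⟨K, hK, fun x a ha F => ?_⟩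
  rw [hcu x a ha, ← hT]
  exact ((T x).norm_coe_le_norm F).trans (hKb x)

/-- Changing signs in the expansion of `x` with respect to an unconditional basis increases the
norm at most by a constant factor. -/
theorem IsUnconditionalBasis.exists_norm_sum_signs_le [CompleteSpace X] {f : ℕ → X}
    (hf : IsUnconditionalBasis 𝕜 f) :
    ∃ K : ℝ, 0 < K ∧ ∀ (x : X) (a : ℕ → 𝕜), HasSum (fun n => a n • f n) x →
      ∀ (F : Finset ℕ) (ε : ℕ → ℤˣ), ‖∑ n ∈ F, ε n • a n • f n‖ ≤ K * ‖x‖ := by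
  obtain ⟨K, hK, h⟩ := hf.exists_norm_sum_le
  -- The indices with sign `1` and those with sign `-1` contribute one `K` each.
  refine ⟨K + K, by positivity, fun x a ha F ε => ?_⟩
  rw [← Finset.sum_filter_add_sum_filter_not F (fun n => ε n = 1), add_mul]
  refine (norm_add_le _ _).trans (add_le_add ?_ ?_)
  · rw [Finset.sum_congr rfl (g := fun n => a n • f n) fun n hn => by
      rw [(Finset.mem_filter.1 hn).2, one_smul]]
    exact h x a ha _
  · rw [Finset.sum_congr rfl (g := fun n => -(a n • f n)) fun n hn => by
      rw [(Int.units_eq_one_or (ε n)).resolve_left (Finset.mem_filter.1 hn).2, Units.neg_smul,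
        one_smul], Finset.sum_neg_distrib, norm_neg]
    exact h x a ha _

/-- A truncated expansion of `x` serves as approximant. With greedy signs its norm dominates the
`ℓ_r`-norm of the coefficients, since `‖f n‖ ≥ m`; with any signs it is at most `K * ‖x‖`. -/
theorem IsUnconditionalBasis.isCSystem [CompleteSpace X] {f : ℕ → X} {r c : ℝ}
    (hf : IsUnconditionalBasis 𝕜 f) (hs : IsSeminormalized f) (hr : 0 < r) (hc : 0 < c)
    (h : ∀ u v : X, ‖u‖ ^ r + c * ‖v‖ ^ r ≤ ‖u + v‖ ^ r ∨ ‖u‖ ^ r + c * ‖v‖ ^ r ≤ ‖u - v‖ ^ r) :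
    IsCSystem 𝕜 r f := by
  obtain ⟨K, hK, hKb⟩ := hf.exists_norm_sum_signs_le
  obtain ⟨m, _, hm, hmb⟩ := hs
  refine ⟨c⁻¹ ^ (1 / r) * (m⁻¹ * K), by positivity, fun x δ hδ => ?_⟩
  obtain ⟨a, ha, -⟩ := hf x
  obtain ⟨F, hF⟩ := ((Metric.tendsto_nhds.1 ha) δ hδ).exists
  have hsupp : ∀ n, (Finsupp.onFinset F (fun n => if n ∈ F then a n else 0)
      (by intro n; simp +contextual)) n = if n ∈ F then a n else 0 := fun n => rfl
  set g := Finsupp.onFinset F (fun n => if n ∈ F then a n else 0)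
    (by intro n; simp +contextual) with hg
  have hsub : g.support ⊆ F := Finsupp.support_onFinset_subset
  refine ⟨g, ?_, ?_⟩
  · rw [Finset.sum_subset hsub fun n _ hn => by rw [Finsupp.notMem_support_iff.1 hn, zero_smul],
      Finset.sum_congr rfl (g := fun n => a n • f n) fun n hn => by rw [hsupp, if_pos hn],
      ← dist_eq_norm, dist_comm]
    exact hF
  · rw [Finset.sum_subset hsub fun n _ hn => by
      rw [Finsupp.notMem_support_iff.1 hn, norm_zero, Real.zero_rpow hr.ne'],
      Finset.sum_congr rfl (g := fun n => ‖a n‖ ^ r) fun n hn => by rw [hsupp, if_pos hn]]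
    obtain ⟨ε, hε⟩ := exists_signs_le_norm_rpow hr h (fun n => a n • f n) F
    have h1 : m ^ r * ∑ n ∈ F, ‖a n‖ ^ r ≤ ∑ n ∈ F, ‖a n • f n‖ ^ r := by
      rw [Finset.mul_sum]
      refine Finset.sum_le_sum fun n _ => ?_
      rw [norm_smul, mul_comm ‖a n‖, Real.mul_rpow (norm_nonneg _) (norm_nonneg _)]
      gcongr
      exact (hmb n).1
    have h2 : ‖∑ n ∈ F, ε n • a n • f n‖ ^ r ≤ (K * ‖x‖) ^ r :=
      Real.rpow_le_rpow (norm_nonneg _) (hKb x a ha F ε) hr.le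
    have h3 : ∑ n ∈ F, ‖a n‖ ^ r ≤ c⁻¹ * (m⁻¹ * (K * ‖x‖)) ^ r := by
      rw [Real.mul_rpow (by positivity) (by positivity), Real.inv_rpow hm.le]
      have : c * (m ^ r * ∑ n ∈ F, ‖a n‖ ^ r) ≤ (K * ‖x‖) ^ r :=
        ((mul_le_mul_of_nonneg_left h1 hc.le).trans hε).trans h2
      rw [inv_mul_eq_div, inv_mul_eq_div, div_div, le_div_iff₀ (by positivity)]
      linarith
    calc (∑ n ∈ F, ‖a n‖ ^ r) ^ (1 / r) ≤ (c⁻¹ * (m⁻¹ * (K * ‖x‖)) ^ r) ^ (1 / r) :=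
          Real.rpow_le_rpow (by positivity) h3 (by positivity)
      _ = c⁻¹ ^ (1 / r) * (m⁻¹ * K) * ‖x‖ := by
          rw [Real.mul_rpow (by positivity) (by positivity), one_div,
            Real.rpow_rpow_inv (by positivity) hr.ne']
          ring

/-- The functional is tested on the Hölder extremal combination `∑ b n • f n`, whose norm is
controlled by the upper `s`-estimate once signs are inserted and then removed. -/
theorem IsUnconditionalBasis.isBesselSequence [CompleteSpace X] {f : ℕ → X} {r s C : ℝ}
    (hrs : r.HolderConjugate s) (hf : IsUnconditionalBasis 𝕜 f) (hs : IsSeminormalized f)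
    (hC : 0 < C)
    (h : ∀ u v : X, ‖u + v‖ ^ s ≤ ‖u‖ ^ s + C * ‖v‖ ^ s ∨ ‖u - v‖ ^ s ≤ ‖u‖ ^ s + C * ‖v‖ ^ s) :
    IsBesselSequence 𝕜 r f := by
  obtain ⟨K, hK, hKb⟩ := hf.exists_norm_sum_signs_le
  obtain ⟨m, M, hm, hmb⟩ := hs
  have hM : 0 < M := hm.trans_le ((hmb 0).1.trans (hmb 0).2)
  have hr0 : 0 < r := hrs.pos
  have hs0 : 0 < s := hrs.symm.pos
  refine ⟨(K * (C ^ s⁻¹ * M)) ^ r, by positivity, fun φ => ?_⟩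
  have hbound : ∀ F : Finset ℕ,
      ∑ n ∈ F, ‖φ (f n)‖ ^ r ≤ (K * (C ^ s⁻¹ * M)) ^ r * ‖φ‖ ^ r := by
    intro F
    set S := ∑ n ∈ F, ‖φ (f n)‖ ^ r with hS
    have hS0 : 0 ≤ S := by positivity
    -- Chosen so that `φ (b n • f n) = ‖b n‖ ^ s = ‖φ (f n)‖ ^ r`. The `star` factor makes it vanish
    -- with `φ (f n)`, whatever the value of `0 ^ (r - 2)`.
    let b : ℕ → 𝕜 := fun n => star (φ (f n)) * ((‖φ (f n)‖ ^ (r - 2) : ℝ) : 𝕜)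
    have hnb : ∀ n, ‖b n‖ ^ s = ‖φ (f n)‖ ^ r := fun n => by
      rcases eq_or_ne (φ (f n)) 0 with h0 | h0
      · simp [b, h0, Real.zero_rpow hr0.ne', Real.zero_rpow hs0.ne']
      · have h1 : 0 < ‖φ (f n)‖ := norm_pos_iff.2 h0
        have h2 : ‖b n‖ = ‖φ (f n)‖ ^ (r - 1) := by
          simp only [b, norm_mul, norm_star]
          rw [RCLike.norm_ofReal, abs_of_nonneg (by positivity), mul_comm,
            ← Real.rpow_add_one h1.ne']
          congr 1; ring
        rw [h2, ← Real.rpow_mul h1.le, hrs.sub_one_mul_conj]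
    have hφb : ∀ n, φ (b n • f n) = ((‖φ (f n)‖ ^ r : ℝ) : 𝕜) := fun n => by
      rcases eq_or_ne (φ (f n)) 0 with h0 | h0
      · simp [b, h0, Real.zero_rpow hr0.ne']
      · have h1 : 0 < ‖φ (f n)‖ := norm_pos_iff.2 h0
        have h2 : star (φ (f n)) * φ (f n) = ((‖φ (f n)‖ ^ 2 : ℝ) : 𝕜) := by
          rw [← starRingEnd_apply, RCLike.conj_mul]; push_cast; rfl
        simp only [b, map_smul, smul_eq_mul]
        rw [mul_right_comm, h2, ← RCLike.ofReal_mul, ← Real.rpow_natCast, ← Real.rpow_add h1]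
        congr 2; push_cast; ring
    obtain ⟨ε, hε⟩ := exists_signs_norm_rpow_le hs0 h (fun n => b n • f n) F
    set G := ∑ n ∈ F, ε n • b n • f n with hG
    have hGsum : HasSum (fun n => (if n ∈ F then ((ε n : ℤ) : 𝕜) * b n else 0) • f n) G := by
      have : G = ∑ n ∈ F, (if n ∈ F then ((ε n : ℤ) : 𝕜) * b n else 0) • f n :=
        Finset.sum_congr rfl fun n hn => by
          rw [if_pos hn, mul_smul ((ε n : ℤ) : 𝕜), Int.cast_smul_eq_zsmul, Units.smul_def]
      rw [this]
      exact hasSum_sum_of_ne_finset_zero fun n hn => by rw [if_neg hn, zero_smul]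
    -- Applying the same signs to `G` again removes them, as `ε n * ε n = 1`.
    have h1 : ‖∑ n ∈ F, b n • f n‖ ≤ K * ‖G‖ := by
      have := hKb G _ hGsum F ε
      rwa [Finset.sum_congr rfl (g := fun n => b n • f n) fun n hn => by
        rw [if_pos hn, mul_smul ((ε n : ℤ) : 𝕜), Int.cast_smul_eq_zsmul, ← Units.smul_def, smul_smul,
          Int.units_mul_self, one_smul]] at this
    have h2 : ‖G‖ ≤ C ^ s⁻¹ * M * S ^ s⁻¹ := by
      have h3 : ‖G‖ ^ s ≤ C * (M ^ s * S) := by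
        refine hε.trans (mul_le_mul_of_nonneg_left ?_ hC.le)
        rw [hS, Finset.mul_sum]
        refine Finset.sum_le_sum fun n _ => ?_
        rw [norm_smul, mul_comm, Real.mul_rpow (norm_nonneg _) (norm_nonneg _), hnb]
        gcongr
        exact (hmb n).2
      calc ‖G‖ = (‖G‖ ^ s) ^ s⁻¹ := (Real.rpow_rpow_inv (norm_nonneg _) hs0.ne').symm
        _ ≤ (C * (M ^ s * S)) ^ s⁻¹ := Real.rpow_le_rpow (by positivity) h3 (by positivity)
        _ = _ := by
          rw [Real.mul_rpow hC.le (by positivity), Real.mul_rpow (by positivity) hS0,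
            Real.rpow_rpow_inv hM.le hs0.ne', mul_assoc]
    have h4 : S ≤ ‖φ‖ * (K * (C ^ s⁻¹ * M * S ^ s⁻¹)) := by
      calc S = ‖φ (∑ n ∈ F, b n • f n)‖ := by
            rw [map_sum, Finset.sum_congr rfl fun n _ => hφb n, ← RCLike.ofReal_sum,
              RCLike.norm_ofReal, abs_of_nonneg hS0]
        _ ≤ ‖φ‖ * ‖∑ n ∈ F, b n • f n‖ := φ.le_opNorm _
        _ ≤ _ := by gcongr; exact h1.trans (by gcongr)
    rcases hS0.eq_or_lt with h0 | hSpos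
    · rw [← h0]; positivity
    have h5 : S ^ r⁻¹ ≤ K * (C ^ s⁻¹ * M) * ‖φ‖ := by
      have h6 : S = S ^ r⁻¹ * S ^ s⁻¹ := by
        rw [← Real.rpow_add hSpos, hrs.inv_add_inv_eq_one, Real.rpow_one]
      have h7 : 0 < S ^ s⁻¹ := by positivity
      refine le_of_mul_le_mul_right ?_ h7
      rw [← h6]
      linarith
    rw [← Real.mul_rpow (by positivity) (norm_nonneg _)]
    calc S = (S ^ r⁻¹) ^ r := (Real.rpow_inv_rpow hS0 hr0.ne').symm
      _ ≤ _ := Real.rpow_le_rpow (by positivity) h5 hr0.le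
  exact ⟨summable_of_sum_le (fun _ => by positivity) hbound,
    Real.tsum_le_of_sum_le (fun _ => by positivity) hbound⟩

end BanachSequence

/-! ### Application to `L^p(ℝ^d)`. -/

theorem mainTheorem3 (𝕜 : Type*) [RCLike 𝕜] (d : ℕ) (p q : ℝ) (hp : 1 < p) (hq : 1 < q)
    (hpq : 1 / p + 1 / q = 1) [Fact (1 ≤ ENNReal.ofReal p)] :
    (p ≤ 2 →
      ∀ f : ℕ → Lp 𝕜 (ENNReal.ofReal p) (volume : Measure (EuclideanSpace ℝ (Fin d))),
        BanachSequence.IsUnconditionalBasis 𝕜 f → BanachSequence.IsSeminormalized f →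
          BanachSequence.IsBesselSequence 𝕜 q f ∧ BanachSequence.IsCSystem 𝕜 2 f) ∧
    (2 ≤ p →
      ∀ f : ℕ → Lp 𝕜 (ENNReal.ofReal p) (volume : Measure (EuclideanSpace ℝ (Fin d))),
        BanachSequence.IsUnconditionalBasis 𝕜 f → BanachSequence.IsSeminormalized f →
          BanachSequence.IsBesselSequence 𝕜 2 f ∧ BanachSequence.IsCSystem 𝕜 p f) := by
  -- Viewing the scalars as a real inner product space treats `ℝ` and `ℂ` together.
  let _ : InnerProductSpace ℝ 𝕜 := InnerProductSpace.rclikeToReal 𝕜 𝕜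
  have hp0 : 0 < p := by linarith
  refine ⟨fun hp2 f hf hs => ⟨?_, ?_⟩, fun hp2 f hf hs => ⟨?_, ?_⟩⟩
  · have hqp : q.HolderConjugate p := by
      rw [Real.holderConjugate_iff]
      exact ⟨hq, by simpa [add_comm] using hpq⟩
    refine hf.isBesselSequence hqp hs one_pos fun u v => ?_
    have := Lp_norm_add_sub_rpow_le hp0 hp2 u v
    -- If both signs failed, averaging would contradict the two-point inequality. In the quadratic
    -- cases the failed inequalities are first raised to the power `p / 2`.
    by_contra! hcon
    linarith [hcon.1, hcon.2]
  · obtain ⟨c, hc0, -, h⟩ := exists_Lp_sq_le_norm_add_sub_rpow (E := 𝕜)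
      (μ := (volume : Measure (EuclideanSpace ℝ (Fin d)))) hp hp2
    refine hf.isCSystem hs two_pos hc0 fun u v => ?_
    simp only [Real.rpow_two]
    by_contra! hcon
    have h1 := Real.rpow_lt_rpow (sq_nonneg _) hcon.1 (half_pos hp0)
    have h2 := Real.rpow_lt_rpow (sq_nonneg _) hcon.2 (half_pos hp0)
    rw [← norm_rpow_eq_sq_rpow_half] at h1 h2
    linarith [h u v]
  · obtain ⟨C, hC, h⟩ := exists_Lp_norm_add_sub_rpow_le_sq (E := 𝕜)
      (μ := (volume : Measure (EuclideanSpace ℝ (Fin d)))) hp2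
    have hC0 : 0 < C := by linarith
    refine hf.isBesselSequence Real.HolderConjugate.two_two hs hC0 fun u v => ?_
    simp only [Real.rpow_two]
    by_contra! hcon
    have h1 := Real.rpow_lt_rpow (by positivity) hcon.1 (half_pos hp0)
    have h2 := Real.rpow_lt_rpow (by positivity) hcon.2 (half_pos hp0)
    rw [← norm_rpow_eq_sq_rpow_half] at h1 h2
    linarith [h u v]
  · refine hf.isCSystem hs hp0 one_pos fun u v => ?_
    have := Lp_le_norm_add_sub_rpow hp2 u v
    by_contra! hcon
    linarith [hcon.1, hcon.2]
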